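/- Write $(x)_k=x(x+1)\cdots(x+k-1)$ for the rising factorial. Both series below converge, and $$\sum_{k=0}^{\infty}\frac{(\frac12)_k^2}{(1)_k^2}\left(\frac{2-\sqrt3}{4}\right)^k\;\cdot\;\sum_{k=0}^{\infty}\frac{(\frac12)_k^2}{(1)_k^2}\left(\frac{2-\sqrt3}{4}\right)^k\left[\left(\frac32+\sqrt3\right)k+\frac14\right]=\frac1\pi .$$ Moreover, put $$d_0=\frac{\sqrt6-\sqrt2}{4},\quad s_0=\sqrt{d_0},\quad b_0=\frac32+\sqrt3,\quad a_0=\frac14,\quad c_0=2\sqrt3,\quad r_0=t_0=\frac{\sqrt3-1}{2}.$$ Then $d_0>0$, $d_0^2=\frac{2-\sqrt3}{4}$, $s_0^2=d_0$, $c_0=b_0/(1-d_0^2)$ and $a_0=r_0-\frac12c_0d_0^2$, and each of the following iterations (for $n\ge 0$) started from these values tends to $1/\pi$. In the first three, $$d_{n+1}=\frac{1-\sqrt{1-d_n^2}}{1+\sqrt{1-d_n^2}}.$$ 1. (Quadratic algorithm) $b_{n+1}=2b_n\dfrac{(1+d_{n+1})^3}{1-d_{n+1}}$, $\;a_{n+1}=a_n(1+d_{n+1})^2+\dfrac{b_{n+1}d_{n+1}}{2(1+d_{n+1})}$;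 then $\lim_{n\to\infty} a_n=1/\pi$. 2. (Simplified quadratic algorithm) $a_{n+1}=a_n(1+d_{n+1})^2+c_0\,2^n d_{n+1}(1-d_{n+1})$; then $\lim_{n\to\infty} a_n=1/\pi$. 3. (Borweins' quadratic algorithm) $r_{n+1}=r_n(1+d_{n+1})^2-c_0\,2^n d_{n+1}$; then $\lim_{n\to\infty} r_n=1/\pi$. 4. (Borweins' quartic algorithm) $s_{n+1}=\dfrac{1-\sqrt[4]{1-s_n^4}}{1+\sqrt[4]{1-s_n^4}}$, $\;t_{n+1}=(1+s_{n+1})^4t_n-c_0\,2^{2n+1}s_{n+1}(1+s_{n+1}+s_{n+1}^2)$; then $\lim_{n\to\infty} t_n=1/\pi$. -/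

import Mathlib

open Real Filter Topology

namespace BorweinPi

/-- The rising factorial `(x)_k = x (x + 1) ⋯ (x + k - 1)`. -/
noncomputable def poch (x : ℝ) (k : ℕ) : ℝ := (ascPochhammer ℝ k).eval x

/-- The modulus sequence `d_n`. -/
noncomputable def dSeq (d₀ : ℝ) : ℕ → ℝ
  | 0 => d₀
  | n + 1 => (1 - √(1 - dSeq d₀ n ^ 2)) / (1 + √(1 - dSeq d₀ n ^ 2))

/-- The sequence `b_n` of the quadratic algorithm. -/
noncomputable def bSeq (d₀ b₀ : ℝ) : ℕ → ℝ
  | 0 => b₀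
  | n + 1 => 2 * bSeq d₀ b₀ n * ((1 + dSeq d₀ (n + 1)) ^ 3 / (1 - dSeq d₀ (n + 1)))

/-- The sequence `a_n` of the quadratic algorithm. -/
noncomputable def aSeq (d₀ b₀ a₀ : ℝ) : ℕ → ℝ
  | 0 => a₀
  | n + 1 => aSeq d₀ b₀ a₀ n * (1 + dSeq d₀ (n + 1)) ^ 2
      + bSeq d₀ b₀ (n + 1) * dSeq d₀ (n + 1) / (2 * (1 + dSeq d₀ (n + 1)))

/-- The sequence `a_n` of the simplified quadratic algorithm. -/
noncomputable def aSimpSeq (d₀ c₀ a₀ : ℝ) : ℕ → ℝ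
  | 0 => a₀
  | n + 1 => aSimpSeq d₀ c₀ a₀ n * (1 + dSeq d₀ (n + 1)) ^ 2
      + c₀ * 2 ^ n * dSeq d₀ (n + 1) * (1 - dSeq d₀ (n + 1))

/-- The sequence `r_n` of the Borweins' quadratic algorithm. -/
noncomputable def rSeq (d₀ c₀ r₀ : ℝ) : ℕ → ℝ
  | 0 => r₀
  | n + 1 => rSeq d₀ c₀ r₀ n * (1 + dSeq d₀ (n + 1)) ^ 2 - c₀ * 2 ^ n * dSeq d₀ (n + 1)

/-- The sequence `s_n` of the Borweins' quartic algorithm. -/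
noncomputable def sSeq (s₀ : ℝ) : ℕ → ℝ
  | 0 => s₀
  | n + 1 => (1 - (1 - sSeq s₀ n ^ 4) ^ (1 / 4 : ℝ)) / (1 + (1 - sSeq s₀ n ^ 4) ^ (1 / 4 : ℝ))

/-- The sequence `t_n` of the Borweins' quartic algorithm. -/
noncomputable def tSeq (s₀ c₀ t₀ : ℝ) : ℕ → ℝ
  | 0 => t₀
  | n + 1 => (1 + sSeq s₀ (n + 1)) ^ 4 * tSeq s₀ c₀ t₀ n
      - c₀ * 2 ^ (2 * n + 1) * sSeq s₀ (n + 1) * (1 + sSeq s₀ (n + 1) + sSeq s₀ (n + 1) ^ 2)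

end BorweinPi

namespace BorweinPi

/-! Write F for `ellF` and x₀ for (2 - √3)/4. Since (1)_k = k!, the first series is F(x₀) and the
second is (1/4)F(x₀) + (3/2 + √3)x₀F'(x₀). Wallis integrals turn both into integrals over [0, π]
with radical Δ = √(1 - x₀ sin² φ). At x₀ the substitution w = m(φ)³ carries B(1/6, 1/2) and B(5/6,
1/2) to multiples of ∫ 1/Δ and ∫ m²/Δ (`beta_eq_cubic_integral`). Gamma reflection evaluates the
product of the Beta values, so the product of the two integrals is π. The integrand of the second
series differs from m²/Δ by an exact derivative (`hasDerivAt_cubic_primitive`), which gives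
`ellF_relation`. For the iterations, Landen's transformation and its derivative make F(d_n²)(a_n
F(d_n²) + b_n d_n² F'(d_n²)) independent of n (`aSeq_invariant`). As d_n → 0, F tends to 1 and the
b_n term vanishes, so a_n tends to the initial value 1/π. The other algorithms follow from b_n =
c₀2ⁿ(1 - d_n²), r_n = a_n + c₀2ⁿ⁻¹d_n² and t_n = r_{2n}. -/

theorem hasSum_of_eq {f g : ℕ → ℝ} {a : ℝ} (h : HasSum f a) (e : ∀ k, f k = g k) :
    HasSum g a := (funext e : f = g) ▸ h

/-! ### Rising factorials and binomial series -/

theorem poch_zero (x : ℝ) : poch x 0 = 1 := by simp [poch]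

theorem poch_succ (x : ℝ) (k : ℕ) : poch x (k + 1) = poch x k * (x + k) := by
  simp [poch, ascPochhammer_succ_eval]

theorem poch_one (k : ℕ) : poch 1 k = k.factorial := by
  simp [poch]

theorem poch_half_succ (k : ℕ) : poch (1 / 2) (k + 1) = 1 / 2 * poch (3 / 2) k := by
  induction k with
  | zero => simp [poch_succ, poch_zero]
  | succ k ih => rw [poch_succ, ih, poch_succ (3 / 2)]; push_cast; ring

/-- The binomial series with negative exponent. -/
theorem hasSum_poch (a : ℝ) {y : ℝ} (hy : |y| < 1) :
    HasSum (fun n : ℕ => poch a n / n.factorial * y ^ n) (1 / (1 - y) ^ a) := by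
  have h := (Real.one_div_one_sub_rpow_hasFPowerSeriesOnBall_zero a).hasSum (y := y)
    (by simpa [enorm_eq_nnnorm, ← NNReal.coe_lt_one] using hy)
  simp only [zero_add] at h
  refine hasSum_of_eq h fun n => ?_
  have hc : Ring.choose (a + n - 1) n = poch a n / n.factorial := by
    rw [Ring.choose, eq_div_iff (by positivity), mul_comm, ← nsmul_eq_mul,
      Ring.factorial_nsmul_multichoose_eq_ascPochhammer, Polynomial.ascPochhammer_smeval_eq_eval]
    rw [poch, show a + n - 1 - n + 1 = a by ring]
  simp [FormalMultilinearSeries.ofScalars, hc]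

/-- The Taylor coefficients of `(1 - y) ^ (-1 / 2)`. -/
noncomputable def coef (k : ℕ) : ℝ := poch (1 / 2) k / k.factorial

theorem coef_succ (k : ℕ) : coef (k + 1) = coef k * ((2 * k + 1) / (2 * k + 2)) := by
  rw [coef, coef, poch_succ, Nat.factorial_succ]
  push_cast
  have : (k.factorial : ℝ) ≠ 0 := by positivity
  field_simp
  ring

theorem coef_nonneg (k : ℕ) : 0 ≤ coef k := by
  induction k with
  | zero => simp [coef, poch_zero]
  | succ k ih => rw [coef_succ]; positivity

theorem coef_le_one (k : ℕ) : coef k ≤ 1 := by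
  induction k with
  | zero => simp [coef, poch_zero]
  | succ k ih =>
    rw [coef_succ]
    refine mul_le_one₀ ih (by positivity) ?_
    rw [div_le_one (by positivity)]
    linarith

theorem integral_sin_pow_eq_coef (k : ℕ) : ∫ φ in 0..π, sin φ ^ (2 * k) = π * coef k := by
  rw [integral_sin_pow_even]
  congr 1
  induction k with
  | zero => simp [coef, poch_zero]
  | succ k ih => rw [Finset.prod_range_succ, ih, coef_succ]

theorem hasSum_coef_mul_pow {y : ℝ} (hy : |y| < 1) :
    HasSum (fun k : ℕ => coef k * y ^ k) (1 / √(1 - y)) := by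
  rw [sqrt_eq_rpow]
  exact hasSum_poch (1 / 2) hy

/-- The factor k cancels against k!, and (1/2)_{k+1} = (1/2)(3/2)_k, so after an index shift this is
y/2 times the binomial series of exponent 3/2. -/
theorem hasSum_coef_mul_nat_mul_pow {y : ℝ} (hy : |y| < 1) :
    HasSum (fun k : ℕ => coef k * k * y ^ k) (y / 2 / √(1 - y) ^ 3) := by
  have hy' := abs_lt.1 hy
  have h := (hasSum_poch (3 / 2) hy).mul_left (y / 2)
  rw [← hasSum_nat_add_iff' 1]
  have e : (1 - y) ^ (3 / 2 : ℝ) = √(1 - y) ^ 3 := by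
    rw [sqrt_eq_rpow, ← rpow_natCast, ← rpow_mul (by linarith)]
    norm_num
  rw [e] at h
  have e' : y / 2 / √(1 - y) ^ 3 - ∑ i ∈ Finset.range 1, coef i * (i : ℝ) * y ^ i
      = y / 2 * (1 / √(1 - y) ^ 3) := by
    simp
    ring
  rw [e']
  refine hasSum_of_eq h fun k => ?_
  rw [coef, poch_half_succ, Nat.factorial_succ]
  push_cast
  have : (k.factorial : ℝ) ≠ 0 := by positivity
  field_simp
  ring

/-! ### Integral representations of F and of x F' -/

/-- Integrating a power series in `x * sin φ ^ 2` termwise. -/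
theorem hasSum_integral_sin {u : ℕ → ℝ} {x : ℝ} {f : ℝ → ℝ}
    (hu : Summable fun k => |u k| * |x| ^ k)
    (hf : ∀ φ, HasSum (fun k => u k * (x * sin φ ^ 2) ^ k) (f φ)) :
    HasSum (fun k => u k * coef k * x ^ k) (1 / π * ∫ φ in 0..π, f φ) := by
  have h := intervalIntegral.hasSum_integral_of_dominated_convergence
    (μ := MeasureTheory.volume) (a := 0) (b := π)
    (F := fun (k : ℕ) φ => u k * (x * sin φ ^ 2) ^ k) (f := f)
    (fun k _ => |u k| * |x| ^ k)
    (fun k => (by fun_prop : Continuous _).aestronglyMeasurable)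
    (fun k => .of_forall fun φ _ => by
      rw [norm_mul, norm_pow, norm_eq_abs, norm_eq_abs, abs_mul]
      gcongr
      refine mul_le_of_le_one_right (abs_nonneg x) ?_
      rw [abs_of_nonneg (sq_nonneg _)]
      exact sin_sq_le_one φ)
    (.of_forall fun _ _ => hu) (by simp) (.of_forall fun φ _ => hf φ)
  refine hasSum_of_eq (h.mul_left (1 / π)) fun k => ?_
  have : ∀ φ, u k * (x * sin φ ^ 2) ^ k = u k * x ^ k * sin φ ^ (2 * k) := fun φ => by
    rw [mul_pow, ← pow_mul]; ring
  simp only [this, intervalIntegral.integral_const_mul, integral_sin_pow_eq_coef]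
  field_simp

theorem abs_mul_sin_sq_lt_one {x : ℝ} (hx : |x| < 1) (φ : ℝ) : |x * sin φ ^ 2| < 1 := by
  rw [abs_mul, abs_of_nonneg (sq_nonneg (sin φ))]
  exact (mul_le_of_le_one_right (abs_nonneg x) (sin_sq_le_one φ)).trans_lt hx

theorem one_sub_mul_sin_sq_pos {x : ℝ} (hx : |x| < 1) (φ : ℝ) : 0 < 1 - x * sin φ ^ 2 := by
  linarith [(abs_lt.1 (abs_mul_sin_sq_lt_one hx φ)).2]

theorem summable_nat_mul_abs_pow {x : ℝ} (hx : |x| < 1) :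
    Summable fun k : ℕ => (k : ℝ) * |x| ^ k := by
  simpa using summable_pow_mul_geometric_of_norm_lt_one 1 (r := |x|) (by simpa using hx)

/-- The hypergeometric function `₂F₁(1/2, 1/2; 1; x)`, that is `2 K / π` at parameter `x`. -/
noncomputable def ellF (x : ℝ) : ℝ := ∑' k : ℕ, coef k ^ 2 * x ^ k

theorem hasSum_ellF_integral {x : ℝ} (hx : |x| < 1) :
    HasSum (fun k : ℕ => coef k ^ 2 * x ^ k)
      (1 / π * ∫ φ in 0..π, 1 / √(1 - x * sin φ ^ 2)) := by
  have h := hasSum_integral_sin (u := coef) (x := x) (f := fun φ => 1 / √(1 - x * sin φ ^ 2))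
    (Summable.of_nonneg_of_le (fun k => by positivity)
      (fun k => mul_le_of_le_one_left (by positivity)
        (by rw [abs_of_nonneg (coef_nonneg k)]; exact coef_le_one k))
      (summable_geometric_of_lt_one (abs_nonneg x) hx))
    (fun φ => hasSum_coef_mul_pow (abs_mul_sin_sq_lt_one hx φ))
  simpa only [sq] using h

theorem hasSum_nat_mul_integral {x : ℝ} (hx : |x| < 1) :
    HasSum (fun k : ℕ => coef k ^ 2 * k * x ^ k)
      (1 / π * ∫ φ in 0..π, x * sin φ ^ 2 / 2 / √(1 - x * sin φ ^ 2) ^ 3) := by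
  have h := hasSum_integral_sin (u := fun k => coef k * k) (x := x)
    (f := fun φ => x * sin φ ^ 2 / 2 / √(1 - x * sin φ ^ 2) ^ 3)
    (Summable.of_nonneg_of_le (fun k => by positivity)
      (fun k => by
        rw [abs_mul, abs_of_nonneg (coef_nonneg k), Nat.abs_cast, mul_assoc]
        exact mul_le_of_le_one_left (by positivity) (coef_le_one k))
      (summable_nat_mul_abs_pow hx))
    (fun φ => hasSum_coef_mul_nat_mul_pow (abs_mul_sin_sq_lt_one hx φ))
  refine hasSum_of_eq h fun k => ?_
  ring

theorem ellF_eq_integral {x : ℝ} (hx : |x| < 1) :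
    ellF x = 1 / π * ∫ φ in 0..π, 1 / √(1 - x * sin φ ^ 2) :=
  (hasSum_ellF_integral hx).tsum_eq

theorem ellF_zero : ellF 0 = 1 := by
  rw [ellF_eq_integral (by simp)]
  simp [pi_ne_zero]

/-! ### Termwise differentiation of F -/

theorem summable_nat_mul_pow_pred {ρ : ℝ} (h0 : 0 ≤ ρ) (h1 : ρ < 1) :
    Summable fun k : ℕ => (k : ℝ) * ρ ^ (k - 1) := by
  rw [← summable_nat_add_iff 1]
  have h := (summable_nat_mul_abs_pow (x := ρ) (by rwa [abs_of_nonneg h0])).add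
    (summable_geometric_of_lt_one h0 h1)
  refine (summable_congr fun k => ?_).1 h
  rw [abs_of_nonneg h0]
  simp
  ring

theorem norm_deriv_term_le {x ρ : ℝ} (hx : |x| ≤ ρ) (k : ℕ) :
    ‖coef k ^ 2 * (k * x ^ (k - 1))‖ ≤ k * ρ ^ (k - 1) := by
  rw [norm_mul, norm_mul, norm_pow, norm_pow]
  simp only [norm_eq_abs, Nat.abs_cast, abs_of_nonneg (coef_nonneg k)]
  refine (mul_le_of_le_one_left (by positivity)
    (pow_le_one₀ (coef_nonneg k) (coef_le_one k))).trans ?_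
  gcongr

theorem hasDerivAt_ellF {x : ℝ} (hx : |x| < 1) :
    HasDerivAt ellF (∑' k : ℕ, coef k ^ 2 * (k * x ^ (k - 1))) x := by
  obtain ⟨ρ, hxρ, hρ⟩ := exists_between hx
  have hρ0 : 0 < ρ := (abs_nonneg x).trans_lt hxρ
  refine hasDerivAt_tsum_of_isPreconnected (u := fun k : ℕ => (k : ℝ) * ρ ^ (k - 1))
    (t := Set.Ioo (-ρ) ρ) (y₀ := 0)
    ?_ isOpen_Ioo isPreconnected_Ioo (fun k y _ => (hasDerivAt_pow k y).const_mul _)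
    (fun k y hy => ?_) (by simp [hρ0]) ?_ (abs_lt.1 hxρ)
  · exact summable_nat_mul_pow_pred hρ0.le hρ
  · exact norm_deriv_term_le (abs_lt.2 hy).le k
  · exact (hasSum_ellF_integral (x := 0) (by simp)).summable

theorem hasDerivAt_deriv_ellF {x : ℝ} (hx : |x| < 1) : HasDerivAt ellF (deriv ellF x) x :=
  (hasDerivAt_ellF hx).differentiableAt.hasDerivAt

theorem norm_deriv_ellF_le {x ρ : ℝ} (hx : |x| ≤ ρ) (hρ : ρ < 1) :
    ‖deriv ellF x‖ ≤ ∑' k : ℕ, (k : ℝ) * ρ ^ (k - 1) := by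
  rw [(hasDerivAt_ellF (hx.trans_lt hρ)).deriv]
  exact tsum_of_norm_bounded
    (summable_nat_mul_pow_pred ((abs_nonneg x).trans hx) hρ).hasSum (norm_deriv_term_le hx)

theorem tsum_nat_mul_eq {x : ℝ} (hx : |x| < 1) :
    ∑' k : ℕ, coef k ^ 2 * k * x ^ k = x * deriv ellF x := by
  rw [(hasDerivAt_ellF hx).deriv, ← tsum_mul_left]
  refine tsum_congr fun k => ?_
  cases k with
  | zero => simp
  | succ k => simp only [Nat.add_sub_cancel, pow_succ]; ring

/-! ### Landen's transformation -/

/-- Landen's substitution `ψ = θ + arcsin (x sin θ)`. -/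
theorem integral_landen {x : ℝ} (hx : |x| < 1) :
    ∫ ψ in 0..π, 1 / √(1 + x ^ 2 + 2 * x * cos ψ) = ∫ θ in 0..π, 1 / √(1 - x ^ 2 * sin θ ^ 2) := by
  have hx' := abs_lt.1 hx
  have hx2 : |x ^ 2| < 1 := by
    rw [abs_of_nonneg (sq_nonneg x)]; nlinarith
  have hpos : ∀ θ, 0 < 1 - x ^ 2 * sin θ ^ 2 := one_sub_mul_sin_sq_pos hx2
  have hpos' : ∀ ψ, 0 < 1 + x ^ 2 + 2 * x * cos ψ := fun ψ => by
    have h1 : |x * cos ψ| < 1 := by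
      rw [abs_mul]
      exact (mul_le_of_le_one_right (abs_nonneg x) (abs_cos_le_one ψ)).trans_lt hx
    have h2 : 0 < 1 + x * cos ψ := by linarith [(abs_lt.1 h1).1]
    -- The radicand is |1 + x exp(iψ)|².
    rw [show 1 + x ^ 2 + 2 * x * cos ψ = (1 + x * cos ψ) ^ 2 + (x * sin ψ) ^ 2 by
      linear_combination (-x ^ 2) * sin_sq_add_cos_sq ψ]
    positivity
  have hlt : ∀ θ, -1 < x * sin θ ∧ x * sin θ < 1 := fun θ => by
    rw [← abs_lt, ← sq_lt_one_iff_abs_lt_one, mul_pow]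
    linarith [hpos θ]
  have hderiv : ∀ θ, HasDerivAt (fun θ => θ + arcsin (x * sin θ))
      (1 + 1 / √(1 - x ^ 2 * sin θ ^ 2) * (x * cos θ)) θ := fun θ => by
    have h1 := (hasDerivAt_arcsin (hlt θ).1.ne' (hlt θ).2.ne).comp θ
      ((hasDerivAt_sin θ).const_mul x)
    rw [mul_pow] at h1
    exact (hasDerivAt_id θ).add h1
  have h := intervalIntegral.integral_comp_mul_deriv (a := 0) (b := π)
    (f := fun θ => θ + arcsin (x * sin θ)) (g := fun ψ => 1 / √(1 + x ^ 2 + 2 * x * cos ψ))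
    (fun θ _ => hderiv θ)
    (Continuous.continuousOn <| by
      have : ∀ θ, √(1 - x ^ 2 * sin θ ^ 2) ≠ 0 := fun θ => (sqrt_pos.2 (hpos θ)).ne'
      fun_prop (disch := assumption))
    (by
      have : ∀ ψ, √(1 + x ^ 2 + 2 * x * cos ψ) ≠ 0 := fun ψ => (sqrt_pos.2 (hpos' ψ)).ne'
      fun_prop (disch := assumption))
  simp only [sin_zero, sin_pi, mul_zero, arcsin_zero, add_zero] at h
  rw [← h]
  refine intervalIntegral.integral_congr fun θ _ => ?_
  simp only [Function.comp_apply]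
  have hΔ := sqrt_pos.2 (hpos θ)
  have hΔ2 := sq_sqrt (hpos θ).le
  rw [cos_add, cos_arcsin, sin_arcsin (hlt θ).1.le (hlt θ).2.le, mul_pow]
  set Δ := √(1 - x ^ 2 * sin θ ^ 2)
  have hsc := sin_sq_add_cos_sq θ
  have habs : |x * cos θ| < Δ := by
    refine abs_lt_of_sq_lt_sq ?_ hΔ.le
    rw [hΔ2, mul_pow]
    nlinarith
  have hp : 0 < Δ + x * cos θ := by linarith [(abs_lt.1 habs).1]
  -- After the substitution the radicand is the perfect square (Δ + x cos θ)², and its root cancels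
  -- the numerator of dψ/dθ = (Δ + x cos θ)/Δ.
  rw [show 1 + x ^ 2 + 2 * x * (cos θ * Δ - sin θ * (x * sin θ)) = (Δ + x * cos θ) ^ 2 by
    linear_combination (-x ^ 2) * hsc - hΔ2, sqrt_sq hp.le]
  field_simp

/-- Halving the angle gives twice the integral over [0, π/2]; the symmetry φ ↦ π - φ restores the
full interval. -/
theorem integral_zero_pi_comp_half {f : ℝ → ℝ} (hf : Continuous f) :
    ∫ ψ in 0..π, f (sin (ψ / 2) ^ 2) = ∫ φ in 0..π, f (sin φ ^ 2) := by
  have hc : Continuous fun φ => f (sin φ ^ 2) := by fun_prop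
  rw [intervalIntegral.integral_comp_div (fun φ => f (sin φ ^ 2)) two_ne_zero,
    ← intervalIntegral.integral_add_adjacent_intervals (a := 0) (b := π / 2) (c := π)
      (hc.intervalIntegrable _ _) (hc.intervalIntegrable _ _)]
  have h := intervalIntegral.integral_comp_sub_left (a := 0) (b := π / 2)
    (fun φ => f (sin φ ^ 2)) π
  simp only [sin_pi_sub, sub_zero] at h
  rw [show π - π / 2 = π / 2 by ring] at h
  rw [← h, zero_div, smul_eq_mul]
  ring

theorem abs_landen_lt_one {x : ℝ} (h0 : 0 ≤ x) (h1 : x < 1) : |4 * x / (1 + x) ^ 2| < 1 := by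
  rw [abs_of_nonneg (by positivity), div_lt_one (by positivity)]
  nlinarith [mul_pos (sub_pos.2 h1) (sub_pos.2 h1)]

/-- Landen's transformation. -/
theorem ellF_landen {x : ℝ} (h0 : 0 ≤ x) (h1 : x < 1) :
    ellF (4 * x / (1 + x) ^ 2) = (1 + x) * ellF (x ^ 2) := by
  have hx : |x| < 1 := by rwa [abs_of_nonneg h0]
  have hk := abs_landen_lt_one h0 h1
  rw [ellF_eq_integral hk, ellF_eq_integral (by rw [abs_of_nonneg (by positivity)]; nlinarith),
    ← integral_landen hx]
  set k := 4 * x / (1 + x) ^ 2 with hkdef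
  have hk0 : 0 ≤ k := by positivity
  have hk1 : k < 1 := (abs_lt.1 hk).2
  -- Clamping t to [0, 1] makes the integrand continuous on all of ℝ without changing it at t = sin²
  -- φ.
  have hf : Continuous fun t : ℝ => 1 / √(1 - k * max 0 (min t 1)) := by
    have : ∀ t : ℝ, √(1 - k * max 0 (min t 1)) ≠ 0 := fun t => by
      refine (sqrt_pos.2 ?_).ne'
      have : max 0 (min t 1) ≤ 1 := by simp
      nlinarith
    fun_prop (disch := assumption)
  have h := integral_zero_pi_comp_half hf
  have hs : ∀ φ, max 0 (min (sin φ ^ 2) 1) = sin φ ^ 2 := fun φ => by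
    rw [min_eq_left (sin_sq_le_one φ), max_eq_right (sq_nonneg _)]
  simp only [hs] at h
  rw [← h, mul_left_comm, ← intervalIntegral.integral_const_mul (1 + x)]
  congr 1
  refine intervalIntegral.integral_congr fun ψ _ => ?_
  have hcos : cos ψ = 1 - 2 * sin (ψ / 2) ^ 2 := by
    rw [show ψ = 2 * (ψ / 2) by ring, cos_two_mul, cos_sq']
    ring_nf
  have hx1 : 0 < 1 + x := by linarith
  rw [show 1 + x ^ 2 + 2 * x * cos ψ = (1 + x) ^ 2 * (1 - k * sin (ψ / 2) ^ 2) by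
    rw [hcos, hkdef]; field_simp; ring, sqrt_mul (by positivity), sqrt_sq hx1.le]
  field_simp

/-- The derivative of Landen's transformation. -/
theorem deriv_ellF_landen {x : ℝ} (h0 : 0 < x) (h1 : x < 1) :
    deriv ellF (4 * x / (1 + x) ^ 2) * (4 * (1 - x) / (1 + x) ^ 3)
      = ellF (x ^ 2) + (1 + x) * (deriv ellF (x ^ 2) * (2 * x)) := by
  have hx1 : 1 + x ≠ 0 := by linarith
  have hx2 : |x ^ 2| < 1 := by rw [abs_of_nonneg (by positivity)]; nlinarith
  have hin : HasDerivAt (fun x : ℝ => 4 * x / (1 + x) ^ 2) (4 * (1 - x) / (1 + x) ^ 3) x := by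
    have := ((hasDerivAt_id x).const_mul 4).div (((hasDerivAt_id x).const_add 1).pow 2)
      (by simpa using hx1)
    refine this.congr_deriv ?_
    simp
    field_simp
    ring
  have hl := (hasDerivAt_deriv_ellF (abs_landen_lt_one h0.le h1)).comp x hin
  have hr := ((hasDerivAt_id x).const_add 1).mul
    (HasDerivAt.comp (h := fun x : ℝ => x ^ 2) x (hasDerivAt_deriv_ellF hx2) (hasDerivAt_pow 2 x))
  have he : (fun x => ellF (4 * x / (1 + x) ^ 2)) =ᶠ[𝓝 x] fun x => (1 + x) * ellF (x ^ 2) := by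
    filter_upwards [Ioo_mem_nhds h0 h1] with z hz using ellF_landen hz.1.le hz.2
  have h := hl.unique (hr.congr_of_eventuallyEq he)
  simpa using h

/-! ### Beta values -/

theorem beta_eq_integral {a b : ℝ} (ha : 0 < a) (hb : 0 < b) :
    ProbabilityTheory.beta a b = ∫ x in (0 : ℝ)..1, x ^ (a - 1) * (1 - x) ^ (b - 1) := by
  rw [ProbabilityTheory.beta_eq_betaIntegralReal a b ha hb, Complex.betaIntegral,
    ← Complex.ofReal_re (∫ x in (0 : ℝ)..1, x ^ (a - 1) * (1 - x) ^ (b - 1)),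
    ← intervalIntegral.integral_ofReal]
  congr 1
  refine intervalIntegral.integral_congr fun x hx => ?_
  rw [Set.uIcc_of_le zero_le_one] at hx
  rw [Complex.ofReal_mul, Complex.ofReal_cpow hx.1, Complex.ofReal_cpow (sub_nonneg.2 hx.2)]
  simp

/-- The product is π Γ(1/6)Γ(5/6) / (Γ(2/3)Γ(4/3)). With Γ(4/3) = Γ(1/3)/3, reflection at 1/6 and at
1/3 evaluates everything. -/
theorem beta_mul_beta :
    ProbabilityTheory.beta (1 / 6) (1 / 2) * ProbabilityTheory.beta (5 / 6) (1 / 2)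
      = 3 * √3 * π := by
  have h1 := Real.Gamma_mul_Gamma_one_sub (1 / 6)
  have h2 := Real.Gamma_mul_Gamma_one_sub (1 / 3)
  have h3 := Real.Gamma_add_one (s := 1 / 3) (by norm_num)
  rw [show π * (1 / 6) = π / 6 by ring, sin_pi_div_six] at h1
  rw [show π * (1 / 3) = π / 3 by ring, sin_pi_div_three] at h2
  norm_num at h1 h2 h3
  have hG1 : 0 < Real.Gamma (1 / 3) := Real.Gamma_pos_of_pos (by norm_num)
  have hG2 : 0 < Real.Gamma (2 / 3) := Real.Gamma_pos_of_pos (by norm_num)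
  have hs : 0 < √3 := by positivity
  have hp : √π ^ 2 = π := sq_sqrt pi_pos.le
  have hpi := pi_pos
  rw [ProbabilityTheory.beta, ProbabilityTheory.beta]
  norm_num
  rw [h3, Real.Gamma_one_half_eq]
  rw [div_mul_div_comm, div_eq_iff (by positivity)]
  rw [eq_div_iff (by positivity)] at h1 h2
  linear_combination 2 * √π ^ 2 * h1 + 2 * π * hp - 2 * π * h2

/-! ### The relation at the third singular value -/

/-- The parameter `x₀ = k²` of the third singular value `k`. -/
noncomputable def x₀ : ℝ := (2 - √3) / 4

theorem sqrt_three_lt_two : √3 < 2 := by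
  rw [sqrt_lt' two_pos]; norm_num

theorem sqrt_three_sq : √3 ^ 2 = 3 := sq_sqrt (by norm_num)

theorem x₀_pos : 0 < x₀ := by
  rw [x₀]; linarith [sqrt_three_lt_two]

theorem abs_x₀_lt_one : |x₀| < 1 := by
  rw [abs_of_pos x₀_pos, x₀]
  linarith [sqrt_nonneg 3]

/-- The denominator of the cubic substitution. -/
noncomputable def cubD (φ : ℝ) : ℝ := 1 + √3 + (1 - √3) * cos φ

/-- The substitution with `w = cubM φ ^ 3` reducing the elliptic integrals at `x₀` to Beta
integrals. -/
noncomputable def cubM (φ : ℝ) : ℝ := (1 + cos φ) / cubD φ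

/-- The elliptic radical at `x₀`. -/
noncomputable def cubΔ (φ : ℝ) : ℝ := √(1 - x₀ * sin φ ^ 2)

theorem cubD_pos (φ : ℝ) : 0 < cubD φ := by
  rw [cubD]
  have h : 1 < √3 := by rw [lt_sqrt zero_le_one]; norm_num
  nlinarith [cos_le_one φ]

theorem cubΔ_pos (φ : ℝ) : 0 < cubΔ φ := sqrt_pos.2 (one_sub_mul_sin_sq_pos abs_x₀_lt_one φ)

theorem cubΔ_sq (φ : ℝ) : cubΔ φ ^ 2 = 1 - x₀ * sin φ ^ 2 :=
  sq_sqrt (one_sub_mul_sin_sq_pos abs_x₀_lt_one φ).le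

theorem continuous_cubD : Continuous cubD := by unfold cubD; fun_prop

theorem continuous_cubΔ : Continuous cubΔ := by unfold cubΔ; fun_prop

theorem continuous_cubM : Continuous cubM := by
  have h := continuous_cubD
  have : ∀ φ, cubD φ ≠ 0 := fun φ => (cubD_pos φ).ne'
  unfold cubM
  fun_prop (disch := assumption)

theorem hasDerivAt_cubD (φ : ℝ) : HasDerivAt cubD ((√3 - 1) * sin φ) φ :=
  (((hasDerivAt_cos φ).const_mul (1 - √3)).const_add (1 + √3)).congr_deriv (by ring)

theorem hasDerivAt_cubM (φ : ℝ) : HasDerivAt cubM (-(2 * √3 * sin φ / cubD φ ^ 2)) φ := by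
  refine (((hasDerivAt_cos φ).const_add 1).div (hasDerivAt_cubD φ) (cubD_pos φ).ne').congr_deriv ?_
  rw [← neg_div]
  congr 1
  rw [cubD]
  ring

theorem hasDerivAt_cubΔ (φ : ℝ) :
    HasDerivAt cubΔ (-(x₀ * sin φ * cos φ / cubΔ φ)) φ := by
  refine (((((hasDerivAt_sin φ).pow 2).const_mul x₀).const_sub 1).sqrt
    (one_sub_mul_sin_sq_pos abs_x₀_lt_one φ).ne').congr_deriv ?_
  simp only [cubΔ]
  simp
  ring

/-- This is where the value of x₀ matters: the quadratic factor of D³ - (1 + cos φ)³ is a multiple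
of Δ², so √(1 - w) brings in the elliptic radical. -/
theorem one_sub_cubM_cube (φ : ℝ) :
    1 - cubM φ ^ 3 = 12 * √3 * (1 - cos φ) * cubΔ φ ^ 2 / cubD φ ^ 3 := by
  have hD := (cubD_pos φ).ne'
  rw [cubΔ_sq, cubM, div_pow, eq_div_iff (by positivity), sub_mul, div_mul_cancel₀ _ (by positivity),
    sin_sq, cubD, x₀]
  have h := sqrt_three_sq
  generalize √3 = r at *
  grind

/-- The cubic substitution in the Beta integrals. -/
theorem beta_eq_cubic_integral {a : ℝ} (ha : 0 < a) :
    ProbabilityTheory.beta a (1 / 2)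
      = √(3 * √3) * ∫ φ in 0..π, cubM φ ^ (3 * a - 1 / 2) / cubΔ φ := by
  have h := intervalIntegral.integral_comp_mul_deriv_of_deriv_nonpos (a := 0) (b := π)
    (f := fun φ => cubM φ ^ 3)
    (f' := fun φ => 3 * cubM φ ^ 2 * (-(2 * √3 * sin φ / cubD φ ^ 2)))
    (g := fun w => w ^ (a - 1) * (1 - w) ^ ((1 / 2 : ℝ) - 1))
    (continuous_cubM.pow 3).continuousOn
    (fun φ _ => ((hasDerivAt_cubM φ).pow 3).congr_deriv (by norm_num))
    (fun φ hφ => by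
      rw [min_eq_left pi_pos.le, max_eq_right pi_pos.le] at hφ
      have := sin_pos_of_mem_Ioo hφ
      have := cubD_pos φ
      rw [mul_neg, neg_nonpos]
      positivity)
  -- The substitution decreases from w = 1 to w = 0, hence the orientation reversals below.
  have e0 : cubM 0 ^ 3 = 1 := by simp [cubM, cubD]
  have e1 : cubM π ^ 3 = 0 := by simp [cubM]
  rw [e0, e1, intervalIntegral.integral_symm, intervalIntegral.integral_symm 0 1,
    ← beta_eq_integral ha (by norm_num : (0 : ℝ) < 1 / 2), ← intervalIntegral.integral_symm] at h
  rw [eq_neg_iff_add_eq_zero, add_comm, ← eq_neg_iff_add_eq_zero] at h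
  rw [h, ← intervalIntegral.integral_neg, ← intervalIntegral.integral_const_mul,
    intervalIntegral.integral_of_le pi_pos.le, intervalIntegral.integral_of_le pi_pos.le,
    MeasureTheory.integral_Ioc_eq_integral_Ioo, MeasureTheory.integral_Ioc_eq_integral_Ioo]
  refine MeasureTheory.setIntegral_congr_fun measurableSet_Ioo fun φ hφ => ?_
  have hs := sin_pos_of_mem_Ioo hφ
  have hD := cubD_pos φ
  have hΔ := cubΔ_pos φ
  have hsc := sin_sq_add_cos_sq φ
  have hc1 : 0 < 1 + cos φ := by nlinarith [neg_one_le_cos φ, cos_le_one φ]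
  have hc2 : 0 < 1 - cos φ := by nlinarith [neg_one_le_cos φ, cos_le_one φ]
  have hm : 0 < cubM φ := div_pos hc1 hD
  have h3 : 0 < √3 := by positivity
  have hE : 0 < 1 - cubM φ ^ 3 := by rw [one_sub_cubM_cube]; positivity
  -- The Jacobian identity; both sides are positive on the open interval, so it may be checked on
  -- squares.
  have key : 6 * √3 * sin φ * cubΔ φ = √(3 * √3) * √(cubM φ) * cubD φ ^ 2 * √(1 - cubM φ ^ 3) := by
    rw [← sq_eq_sq₀ (by positivity) (by positivity)]
    simp only [mul_pow, sq_sqrt hm.le, sq_sqrt hE.le, sq_sqrt (show 0 ≤ 3 * √3 by positivity)]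
    rw [one_sub_cubM_cube, cubM, sqrt_three_sq]
    field_simp
    rw [sqrt_three_sq]
    linear_combination 36 * hsc
  have hpow : (cubM φ ^ 3) ^ (a - 1) * cubM φ ^ 2 * √(cubM φ) = cubM φ ^ (3 * a - 1 / 2) := by
    rw [sqrt_eq_rpow, ← rpow_natCast, ← rpow_natCast, ← rpow_mul hm.le, ← rpow_add hm,
      ← rpow_add hm]
    congr 1
    push_cast
    ring
  have hE' : (1 - cubM φ ^ 3) ^ ((1 / 2 : ℝ) - 1) = 1 / √(1 - cubM φ ^ 3) := by
    rw [show (1 / 2 : ℝ) - 1 = -(1 / 2) by norm_num, rpow_neg hE.le, ← sqrt_eq_rpow, one_div]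
  have hE2 := sqrt_pos.2 hE
  simp only [Function.comp_apply]
  rw [hE', ← hpow]
  field_simp
  linear_combination key

/-- The exponent 3a - 1/2 is 0 for a = 1/6 and 2 for a = 5/6. -/
theorem cubic_integral_mul :
    (∫ φ in 0..π, 1 / cubΔ φ) * (∫ φ in 0..π, cubM φ ^ 2 / cubΔ φ) = π := by
  have h1 := beta_eq_cubic_integral (a := 1 / 6) (by norm_num)
  have h2 := beta_eq_cubic_integral (a := 5 / 6) (by norm_num)
  have h := beta_mul_beta
  norm_num at h1 h2 h
  rw [h1, h2] at h
  have hk : √(3 * √3) ^ 2 = 3 * √3 := sq_sqrt (by positivity)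
  rw [sqrt_mul (by norm_num)] at hk
  have h3 : 0 < 3 * √3 := by positivity
  simp only [one_div]
  refine mul_left_cancel₀ h3.ne' ?_
  rw [← h, ← hk]
  ring

/-- The factor sin φ makes this primitive vanish at 0 and π, so the two integrands have equal
integrals. -/
theorem hasDerivAt_cubic_primitive (φ : ℝ) :
    HasDerivAt (fun φ => sin φ * (-3 - √3 + (√3 - 3) * cos φ) / (cubD φ * cubΔ φ))
      (4 * (1 / 4 * (1 / cubΔ φ) + (3 / 2 + √3) * (x₀ * sin φ ^ 2 / 2 / cubΔ φ ^ 3)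
        - cubM φ ^ 2 / cubΔ φ)) φ := by
  have hD := cubD_pos φ
  have hΔ := cubΔ_pos φ
  have h := ((hasDerivAt_sin φ).mul
    (((hasDerivAt_cos φ).const_mul (√3 - 3)).const_add (-3 - √3))).div
    ((hasDerivAt_cubD φ).mul (hasDerivAt_cubΔ φ)) (mul_pos hD hΔ).ne'
  refine h.congr_deriv ?_
  -- The numerators over the common denominator D²Δ³; eliminating Δ² and sin² φ leaves a polynomial
  -- identity in cos φ modulo √3² = 3.
  have key : ((cos φ * (-3 - √3 + (√3 - 3) * cos φ) - (√3 - 3) * sin φ ^ 2) * cubD φ * cubΔ φ ^ 2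
      - sin φ ^ 2 * (-3 - √3 + (√3 - 3) * cos φ)
        * ((√3 - 1) * cubΔ φ ^ 2 - cubD φ * x₀ * cos φ))
      = cubD φ ^ 2 * cubΔ φ ^ 2 + 2 * (3 / 2 + √3) * x₀ * sin φ ^ 2 * cubD φ ^ 2
        - 4 * (1 + cos φ) ^ 2 * cubΔ φ ^ 2 := by
    rw [cubΔ_sq, sin_sq, cubD, x₀]
    have h := sqrt_three_sq
    generalize √3 = r at *
    grind
  have e : 4 * (1 / 4 * (1 / cubΔ φ) + (3 / 2 + √3) * (x₀ * sin φ ^ 2 / 2 / cubΔ φ ^ 3)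
        - cubM φ ^ 2 / cubΔ φ)
      = (cubD φ ^ 2 * cubΔ φ ^ 2 + 2 * (3 / 2 + √3) * x₀ * sin φ ^ 2 * cubD φ ^ 2
        - 4 * (1 + cos φ) ^ 2 * cubΔ φ ^ 2) / (cubD φ ^ 2 * cubΔ φ ^ 3) := by
    rw [cubM]
    field_simp
    ring
  rw [e, ← key]
  simp only [Pi.mul_apply]
  field_simp
  ring

theorem continuous_rational_integrands :
    (Continuous fun φ => 1 / cubΔ φ) ∧ (Continuous fun φ => x₀ * sin φ ^ 2 / 2 / cubΔ φ ^ 3) ∧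
      Continuous fun φ => cubM φ ^ 2 / cubΔ φ := by
  have h1 := continuous_cubΔ
  have h2 := continuous_cubM
  have h3 : ∀ φ, cubΔ φ ≠ 0 := fun φ => (cubΔ_pos φ).ne'
  have h4 : ∀ φ, cubΔ φ ^ 3 ≠ 0 := fun φ => pow_ne_zero 3 (h3 φ)
  refine ⟨?_, ?_, ?_⟩ <;> fun_prop (disch := assumption)

theorem cubic_integral_eq :
    1 / 4 * (∫ φ in 0..π, 1 / cubΔ φ)
      + (3 / 2 + √3) * (∫ φ in 0..π, x₀ * sin φ ^ 2 / 2 / cubΔ φ ^ 3)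
      = ∫ φ in 0..π, cubM φ ^ 2 / cubΔ φ := by
  obtain ⟨h1, h2, h3⟩ := continuous_rational_integrands
  have h := intervalIntegral.integral_eq_sub_of_hasDerivAt (a := 0) (b := π)
    (fun φ _ => hasDerivAt_cubic_primitive φ)
    ((((h1.const_mul _).add (h2.const_mul _)).sub h3).const_mul 4 |>.intervalIntegrable _ _)
  have h12 : Continuous fun φ => 1 / 4 * (1 / cubΔ φ)
      + (3 / 2 + √3) * (x₀ * sin φ ^ 2 / 2 / cubΔ φ ^ 3) := (h1.const_mul _).add (h2.const_mul _)
  rw [intervalIntegral.integral_const_mul, intervalIntegral.integral_sub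
    (h12.intervalIntegrable _ _) (h3.intervalIntegrable _ _),
    intervalIntegral.integral_add ((h1.const_mul _).intervalIntegrable _ _)
      ((h2.const_mul _).intervalIntegrable _ _),
    intervalIntegral.integral_const_mul, intervalIntegral.integral_const_mul] at h
  simp only [sin_zero, sin_pi, zero_mul, zero_div, sub_zero] at h
  linarith

/-- The Legendre-type relation at the third singular value. -/
theorem ellF_relation :
    ellF x₀ * (1 / 4 * ellF x₀ + (3 / 2 + √3) * (x₀ * deriv ellF x₀)) = 1 / π := by
  rw [← tsum_nat_mul_eq abs_x₀_lt_one, (hasSum_nat_mul_integral abs_x₀_lt_one).tsum_eq,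
    ellF_eq_integral abs_x₀_lt_one]
  have h1 := cubic_integral_mul
  rw [← cubic_integral_eq] at h1
  simp only [cubΔ] at h1
  have hp := pi_ne_zero
  generalize (∫ φ in 0..π, 1 / √(1 - x₀ * sin φ ^ 2)) = I at *
  generalize (∫ φ in 0..π, x₀ * sin φ ^ 2 / 2 / √(1 - x₀ * sin φ ^ 2) ^ 3) = J at *
  field_simp
  linear_combination 8 * h1

/-! ### Quadratic iterations -/

section Iterations

variable {d₀ : ℝ}

theorem dSeq_mem (h : d₀ ∈ Set.Ioo 0 1) (n : ℕ) : dSeq d₀ n ∈ Set.Ioo 0 1 := by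
  induction n with
  | zero => exact h
  | succ n ih =>
    obtain ⟨h0, h1⟩ := ih
    have hq : 0 < 1 - dSeq d₀ n ^ 2 := by nlinarith
    have hs := sqrt_pos.2 hq
    have hs1 : √(1 - dSeq d₀ n ^ 2) < 1 := by
      rw [sqrt_lt' one_pos]; nlinarith
    rw [dSeq]
    exact ⟨div_pos (by linarith) (by linarith), (div_lt_one (by linarith)).2 (by linarith)⟩

theorem sqrt_one_sub_dSeq (d₀ : ℝ) (n : ℕ) :
    √(1 - dSeq d₀ n ^ 2) = (1 - dSeq d₀ (n + 1)) / (1 + dSeq d₀ (n + 1)) := by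
  have h1 : 0 ≤ √(1 - dSeq d₀ n ^ 2) := sqrt_nonneg _
  rw [dSeq]
  field_simp
  ring

theorem dSeq_sq (h : d₀ ∈ Set.Ioo 0 1) (n : ℕ) :
    dSeq d₀ n ^ 2 = 4 * dSeq d₀ (n + 1) / (1 + dSeq d₀ (n + 1)) ^ 2 := by
  have h1 := dSeq_mem h n
  have h2 := dSeq_mem h (n + 1)
  have h3 := sq_sqrt (show 0 ≤ 1 - dSeq d₀ n ^ 2 by nlinarith [h1.1, h1.2])
  rw [sqrt_one_sub_dSeq] at h3
  have h4 : 1 + dSeq d₀ (n + 1) ≠ 0 := by linarith [h2.1]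
  rw [← sub_eq_iff_eq_add'.2 (sub_add_cancel 1 (dSeq d₀ n ^ 2)).symm, ← h3]
  field_simp
  ring

theorem dSeq_succ_le (h : d₀ ∈ Set.Ioo 0 1) (n : ℕ) : dSeq d₀ (n + 1) ≤ dSeq d₀ n ^ 2 := by
  have h2 := dSeq_mem h (n + 1)
  have h3 : 0 < 1 + dSeq d₀ (n + 1) := by linarith [h2.1]
  rw [dSeq_sq h, le_div_iff₀ (by positivity)]
  have : (1 + dSeq d₀ (n + 1)) ^ 2 ≤ 4 := by nlinarith [h2.1, h2.2]
  nlinarith [h2.1]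

/-- Convergence is in fact quadratic, but for d₀ < 1/2 this geometric bound already beats the growth
2ⁿ of b_n. -/
theorem dSeq_le_pow (h : d₀ ∈ Set.Ioo 0 1) (n : ℕ) : dSeq d₀ n ≤ d₀ ^ (n + 1) := by
  have hle : ∀ n, dSeq d₀ n ≤ d₀ := fun n => by
    induction n with
    | zero => rfl
    | succ n ih => nlinarith [dSeq_succ_le h n, dSeq_mem h n |>.1, dSeq_mem h n |>.2]
  induction n with
  | zero => simp [dSeq]
  | succ n ih =>
    calc dSeq d₀ (n + 1) ≤ dSeq d₀ n * dSeq d₀ n := by rw [← sq]; exact dSeq_succ_le h n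
      _ ≤ d₀ ^ (n + 1) * d₀ := mul_le_mul ih (hle n) (dSeq_mem h n).1.le (pow_pos h.1 _).le
      _ = _ := (pow_succ _ _).symm

theorem tendsto_two_pow_mul_dSeq (h : d₀ ∈ Set.Ioo 0 (1 / 2)) :
    Tendsto (fun n => 2 ^ n * dSeq d₀ n) atTop (𝓝 0) := by
  have h' : d₀ ∈ Set.Ioo 0 1 := ⟨h.1, h.2.trans (by norm_num)⟩
  have ht := (tendsto_pow_atTop_nhds_zero_of_lt_one (r := 2 * d₀) (by linarith [h.1])
    (by linarith [h.2])).mul_const d₀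
  rw [zero_mul] at ht
  refine squeeze_zero (fun n => mul_nonneg (by positivity) (dSeq_mem h' n).1.le) (fun n => ?_) ht
  rw [mul_pow, mul_assoc, ← pow_succ]
  gcongr
  exact dSeq_le_pow h' n

theorem tendsto_dSeq (h : d₀ ∈ Set.Ioo 0 (1 / 2)) : Tendsto (dSeq d₀) atTop (𝓝 0) := by
  have h' : d₀ ∈ Set.Ioo 0 1 := ⟨h.1, h.2.trans (by norm_num)⟩
  refine squeeze_zero (fun n => (dSeq_mem h' n).1.le) (fun n => ?_) (tendsto_two_pow_mul_dSeq h)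
  exact le_mul_of_one_le_left (dSeq_mem h' n).1.le (one_le_pow₀ one_le_two)

theorem tendsto_two_pow_mul_dSeq_sq (h : d₀ ∈ Set.Ioo 0 (1 / 2)) :
    Tendsto (fun n => 2 ^ n * dSeq d₀ n ^ 2) atTop (𝓝 0) := by
  have := (tendsto_two_pow_mul_dSeq h).mul (tendsto_dSeq h)
  simpa [sq, mul_assoc] using this

/-- With y = d_{n+1}, 1 - d_n² = ((1 - y)/(1 + y))², so b_n/(1 - d_n²) exactly doubles at each step.
-/
theorem bSeq_eq (h : d₀ ∈ Set.Ioo 0 1) {b₀ c₀ : ℝ} (hc : c₀ = b₀ / (1 - d₀ ^ 2)) (n : ℕ) :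
    bSeq d₀ b₀ n = c₀ * 2 ^ n * (1 - dSeq d₀ n ^ 2) := by
  induction n with
  | zero =>
    have : 1 - d₀ ^ 2 ≠ 0 := by nlinarith [h.1, h.2]
    simp [bSeq, dSeq, hc, this]
  | succ n ih =>
    have h2 := dSeq_mem h (n + 1)
    rw [bSeq, ih, dSeq_sq h]
    have h3 : 1 + dSeq d₀ (n + 1) ≠ 0 := by linarith [h2.1]
    have h4 : 1 - dSeq d₀ (n + 1) ≠ 0 := by linarith [h2.2]
    field_simp
    ring

/-- The quadratic algorithm leaves this quantity invariant. -/
theorem aSeq_invariant (h : d₀ ∈ Set.Ioo 0 1) (b₀ a₀ : ℝ) (n : ℕ) :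
    ellF (dSeq d₀ n ^ 2) * (aSeq d₀ b₀ a₀ n * ellF (dSeq d₀ n ^ 2)
      + bSeq d₀ b₀ n * (dSeq d₀ n ^ 2 * deriv ellF (dSeq d₀ n ^ 2)))
    = ellF (d₀ ^ 2) * (a₀ * ellF (d₀ ^ 2) + b₀ * (d₀ ^ 2 * deriv ellF (d₀ ^ 2))) := by
  induction n with
  | zero => simp [aSeq, bSeq, dSeq]
  | succ n ih =>
    rw [← ih, aSeq, bSeq, dSeq_sq h n]
    obtain ⟨h0, h1⟩ := dSeq_mem h (n + 1)
    generalize dSeq d₀ (n + 1) = y at *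
    have hd := deriv_ellF_landen h0 h1
    rw [ellF_landen h0.le h1]
    have h3 : 1 + y ≠ 0 := by linarith
    have h4 : 1 - y ≠ 0 := by linarith
    have hd' : deriv ellF (4 * y / (1 + y) ^ 2) = (ellF (y ^ 2)
        + (1 + y) * (deriv ellF (y ^ 2) * (2 * y))) * ((1 + y) ^ 3 / (4 * (1 - y))) := by
      rw [← hd]
      field_simp
    rw [hd']
    field_simp
    ring

theorem tendsto_aSeq (h : d₀ ∈ Set.Ioo 0 (1 / 2)) {a₀ b₀ L : ℝ}
    (hL : ellF (d₀ ^ 2) * (a₀ * ellF (d₀ ^ 2) + b₀ * (d₀ ^ 2 * deriv ellF (d₀ ^ 2))) = L) :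
    Tendsto (aSeq d₀ b₀ a₀) atTop (𝓝 L) := by
  have h' : d₀ ∈ Set.Ioo 0 1 := ⟨h.1, h.2.trans (by norm_num)⟩
  have hd2 : Tendsto (fun n => dSeq d₀ n ^ 2) atTop (𝓝 0) := by
    simpa using (tendsto_dSeq h).pow 2
  have hF : Tendsto (fun n => ellF (dSeq d₀ n ^ 2)) atTop (𝓝 1) := by
    have hc := (hasDerivAt_ellF (x := 0) (by simp)).continuousAt.tendsto
    rw [ellF_zero] at hc
    exact hc.comp hd2
  have hb : Tendsto (fun n => bSeq d₀ b₀ n * dSeq d₀ n ^ 2) atTop (𝓝 0) := by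
    have ht := ((tendsto_two_pow_mul_dSeq_sq h).mul (hd2.const_sub 1)).const_mul
      (b₀ / (1 - d₀ ^ 2))
    rw [zero_mul, mul_zero] at ht
    refine ht.congr fun n => ?_
    rw [bSeq_eq h' rfl]
    ring
  have hU : Tendsto (fun n => bSeq d₀ b₀ n * dSeq d₀ n ^ 2 * deriv ellF (dSeq d₀ n ^ 2))
      atTop (𝓝 0) := by
    refine hb.zero_mul_isBoundedUnder_le (isBoundedUnder_of_eventually_le
      (a := ∑' k : ℕ, (k : ℝ) * (1 / 2) ^ (k - 1)) ?_)
    filter_upwards [hd2.eventually_le_const (show (0 : ℝ) < 1 / 2 by norm_num)] with n hn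
    exact norm_deriv_ellF_le (by rwa [abs_of_nonneg (sq_nonneg _)]) (by norm_num)
  -- The invariant solved for a_n: a_n = (L - F·U)/F², with F → 1 and U → 0.
  have ht := ((hF.mul hU).const_sub L).div (hF.pow 2) (by norm_num)
  rw [mul_zero, sub_zero, one_pow, div_one] at ht
  refine ht.congr' ?_
  filter_upwards [hF.eventually_ne one_ne_zero] with n hn
  rw [← hL, ← aSeq_invariant h' b₀ a₀ n]
  simp only [Pi.div_apply]
  field_simp
  ring

theorem aSimpSeq_eq_aSeq (h : d₀ ∈ Set.Ioo 0 1) {a₀ b₀ c₀ : ℝ} (hc : c₀ = b₀ / (1 - d₀ ^ 2)) :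
    aSimpSeq d₀ c₀ a₀ = aSeq d₀ b₀ a₀ := by
  funext n
  induction n with
  | zero => rfl
  | succ n ih =>
    rw [aSimpSeq, aSeq, ih, bSeq_eq h hc]
    have h3 : 1 + dSeq d₀ (n + 1) ≠ 0 := by linarith [(dSeq_mem h (n + 1)).1]
    field_simp
    ring

theorem rSeq_eq (h : d₀ ∈ Set.Ioo 0 1) {a₀ r₀ c₀ : ℝ} (ha : a₀ = r₀ - c₀ * 2⁻¹ * d₀ ^ 2) (n : ℕ) :
    rSeq d₀ c₀ r₀ n = aSimpSeq d₀ c₀ a₀ n + c₀ * 2⁻¹ * 2 ^ n * dSeq d₀ n ^ 2 := by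
  induction n with
  | zero => simp [rSeq, aSimpSeq, dSeq, ha]
  | succ n ih =>
    rw [aSimpSeq, rSeq, ih, dSeq_sq h n]
    have h3 : 1 + dSeq d₀ (n + 1) ≠ 0 := by linarith [(dSeq_mem h (n + 1)).1]
    field_simp
    ring

theorem tendsto_rSeq (h : d₀ ∈ Set.Ioo 0 (1 / 2)) {a₀ r₀ c₀ L : ℝ}
    (ha : a₀ = r₀ - c₀ * 2⁻¹ * d₀ ^ 2) (hL : Tendsto (aSimpSeq d₀ c₀ a₀) atTop (𝓝 L)) :
    Tendsto (rSeq d₀ c₀ r₀) atTop (𝓝 L) := by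
  have h' : d₀ ∈ Set.Ioo 0 1 := ⟨h.1, h.2.trans (by norm_num)⟩
  have ht := hL.add ((tendsto_two_pow_mul_dSeq_sq h).const_mul (c₀ * 2⁻¹))
  rw [mul_zero, add_zero] at ht
  refine ht.congr fun n => ?_
  rw [rSeq_eq h' ha]
  ring

/-! ### The quartic iteration -/

theorem dSeq_succ_of_sq {n : ℕ} {s q : ℝ} (hqs : q ^ 4 = 1 - s ^ 4)
    (hd : dSeq d₀ n = s ^ 2) : dSeq d₀ (n + 1) = (1 - q ^ 2) / (1 + q ^ 2) := by
  rw [dSeq, hd, show 1 - (s ^ 2) ^ 2 = (q ^ 2) ^ 2 by linear_combination -hqs,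
    sqrt_sq (by positivity)]

/-- With q the fourth root of 1 - s⁴, both nested square roots become rational in q. -/
theorem dSeq_add_two_of_sq {n : ℕ} {s q : ℝ} (hq : 0 ≤ q) (hqs : q ^ 4 = 1 - s ^ 4)
    (hd : dSeq d₀ n = s ^ 2) : dSeq d₀ (n + 2) = ((1 - q) / (1 + q)) ^ 2 := by
  rw [dSeq, dSeq_succ_of_sq hqs hd,
    show 1 - ((1 - q ^ 2) / (1 + q ^ 2)) ^ 2 = (2 * q / (1 + q ^ 2)) ^ 2 by field_simp; ring,
    sqrt_sq (by positivity)]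
  have : 1 + 2 * q / (1 + q ^ 2) ≠ 0 := by positivity
  field_simp
  ring

theorem fourth_root_pow {x : ℝ} (hx : 0 ≤ x) : (x ^ (1 / 4 : ℝ)) ^ 4 = x := by
  rw [← rpow_natCast, ← rpow_mul hx]
  norm_num

theorem dSeq_two_mul (h : d₀ ∈ Set.Ioo 0 1) {s₀ : ℝ} (hs : s₀ ^ 2 = d₀) (n : ℕ) :
    dSeq d₀ (2 * n) = sSeq s₀ n ^ 2 := by
  induction n with
  | zero => simp [dSeq, sSeq, hs]
  | succ n ih =>
    have hx : 0 ≤ 1 - sSeq s₀ n ^ 4 := by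
      rw [show sSeq s₀ n ^ 4 = (sSeq s₀ n ^ 2) ^ 2 by ring, ← ih]
      nlinarith [(dSeq_mem h (2 * n)).1, (dSeq_mem h (2 * n)).2]
    rw [mul_add, mul_one, sSeq]
    exact dSeq_add_two_of_sq (rpow_nonneg hx _) (fourth_root_pow hx) ih

theorem dSeq_two_mul_add_one (h : d₀ ∈ Set.Ioo 0 1) {s₀ : ℝ} (hs : s₀ ^ 2 = d₀) (n : ℕ) :
    dSeq d₀ (2 * n + 1) = 2 * sSeq s₀ (n + 1) / (1 + sSeq s₀ (n + 1) ^ 2) := by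
  have hx : 0 ≤ 1 - sSeq s₀ n ^ 4 := by
    rw [show sSeq s₀ n ^ 4 = (sSeq s₀ n ^ 2) ^ 2 by ring, ← dSeq_two_mul h hs]
    nlinarith [(dSeq_mem h (2 * n)).1, (dSeq_mem h (2 * n)).2]
  have hq := rpow_nonneg hx (1 / 4)
  rw [dSeq_succ_of_sq (fourth_root_pow hx) (dSeq_two_mul h hs n), sSeq]
  generalize (1 - sSeq s₀ n ^ 4) ^ (1 / 4 : ℝ) = q at *
  field_simp
  ring

/-- One step of the quartic algorithm is two steps of the quadratic algorithm. -/
theorem tSeq_eq (h : d₀ ∈ Set.Ioo 0 1) {s₀ : ℝ} (hs : s₀ ^ 2 = d₀) (c₀ r₀ : ℝ) (n : ℕ) :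
    tSeq s₀ c₀ r₀ n = rSeq d₀ c₀ r₀ (2 * n) := by
  induction n with
  | zero => simp [tSeq, rSeq]
  | succ n ih =>
    have h2 : dSeq d₀ (2 * n + 1 + 1) = sSeq s₀ (n + 1) ^ 2 := dSeq_two_mul h hs (n + 1)
    rw [tSeq, ih, show 2 * (n + 1) = 2 * n + 1 + 1 by ring, rSeq, rSeq, h2, dSeq_two_mul_add_one h hs]
    field_simp
    ring

end Iterations

end BorweinPi

/-! ### Assembly at the given initial values -/

theorem mainTheorem7 :
    -- the two series converge and the product of their sums is `1 / π`
    (Summable (fun k : ℕ =>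
        BorweinPi.poch (1 / 2) k ^ 2 / BorweinPi.poch 1 k ^ 2 * ((2 - √3) / 4) ^ k) ∧
      Summable (fun k : ℕ =>
        BorweinPi.poch (1 / 2) k ^ 2 / BorweinPi.poch 1 k ^ 2 * ((2 - √3) / 4) ^ k
          * ((3 / 2 + √3) * (k : ℝ) + 1 / 4)) ∧
      (∑' k : ℕ, BorweinPi.poch (1 / 2) k ^ 2 / BorweinPi.poch 1 k ^ 2 * ((2 - √3) / 4) ^ k) *
        (∑' k : ℕ, BorweinPi.poch (1 / 2) k ^ 2 / BorweinPi.poch 1 k ^ 2 * ((2 - √3) / 4) ^ k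
          * ((3 / 2 + √3) * (k : ℝ) + 1 / 4)) = 1 / π) ∧
    -- the corresponding initial values, and the limits of the algorithms started from them
    ∀ d₀ s₀ b₀ a₀ c₀ r₀ t₀ : ℝ,
      d₀ = (√6 - √2) / 4 → s₀ = √d₀ → b₀ = 3 / 2 + √3 → a₀ = 1 / 4 →
      c₀ = 2 * √3 → r₀ = (√3 - 1) / 2 → t₀ = r₀ →
      -- they come from the identity
      (0 < d₀ ∧ d₀ ^ 2 = (2 - √3) / 4 ∧ s₀ ^ 2 = d₀ ∧
        c₀ = b₀ / (1 - d₀ ^ 2) ∧ a₀ = r₀ - c₀ * 2⁻¹ * d₀ ^ 2) ∧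
      -- all the iterations tend to `1 / π`
      Tendsto (BorweinPi.aSeq d₀ b₀ a₀) atTop (𝓝 (1 / π)) ∧
      Tendsto (BorweinPi.aSimpSeq d₀ c₀ a₀) atTop (𝓝 (1 / π)) ∧
      Tendsto (BorweinPi.rSeq d₀ c₀ r₀) atTop (𝓝 (1 / π)) ∧
      Tendsto (BorweinPi.tSeq s₀ c₀ t₀) atTop (𝓝 (1 / π)) := by
  have hcoef : ∀ k, BorweinPi.poch (1 / 2) k ^ 2 / BorweinPi.poch 1 k ^ 2 = BorweinPi.coef k ^ 2 :=
    fun k => by rw [BorweinPi.poch_one, BorweinPi.coef, div_pow]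
  have hx : |(2 - √3) / 4| < 1 := BorweinPi.abs_x₀_lt_one
  have hrel := BorweinPi.ellF_relation
  have hF := BorweinPi.hasSum_ellF_integral hx
  have hK := BorweinPi.hasSum_nat_mul_integral hx
  have hF' := hF.tsum_eq
  have hK' := hK.tsum_eq
  have h2 := BorweinPi.hasSum_of_eq ((hK.mul_left (3 / 2 + √3)).add (hF.mul_left (1 / 4)))
    (g := fun k : ℕ => BorweinPi.coef k ^ 2 * ((2 - √3) / 4) ^ k
      * ((3 / 2 + √3) * (k : ℝ) + 1 / 4)) fun k => by ring
  rw [BorweinPi.x₀] at hrel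
  simp only [hcoef]
  refine ⟨⟨hF.summable, h2.summable, ?_⟩, ?_⟩
  · rw [h2.tsum_eq, ← hF', ← hK', BorweinPi.tsum_nat_mul_eq hx, ← hrel, BorweinPi.ellF]
    ring
  · rintro d₀ s₀ b₀ a₀ c₀ r₀ t₀ hd hs hb ha hc hr ht
    have h3 := BorweinPi.sqrt_three_sq
    have h32 := BorweinPi.sqrt_three_lt_two
    have hs2 : √2 ^ 2 = 2 := sq_sqrt (by norm_num)
    have h6 : √6 = √3 * √2 := by rw [← sqrt_mul (by norm_num)]; norm_num
    have hd2 : d₀ ^ 2 = (2 - √3) / 4 := by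
      rw [hd, h6]
      linear_combination ((√3 - 1) ^ 2 / 16) * hs2 + 1 / 8 * h3
    have hd0 : 0 < d₀ := by
      rw [hd]
      exact div_pos (sub_pos.2 (sqrt_lt_sqrt (by norm_num) (by norm_num))) (by norm_num)
    have h31 : 1 < √3 := by rw [lt_sqrt zero_le_one]; norm_num
    -- Since √3 > 1, d₀² = (2 - √3)/4 < 1/4.
    have hd1 : d₀ < 1 / 2 := by nlinarith
    have hmem : d₀ ∈ Set.Ioo 0 (1 / 2) := ⟨hd0, hd1⟩
    have hmem' : d₀ ∈ Set.Ioo 0 1 := ⟨hd0, by linarith⟩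
    have hs' : s₀ ^ 2 = d₀ := by rw [hs, sq_sqrt hd0.le]
    have hc' : c₀ = b₀ / (1 - d₀ ^ 2) := by
      rw [hd2, hc, hb, eq_div_iff (by linarith)]
      linear_combination 1 / 2 * h3
    have ha' : a₀ = r₀ - c₀ * 2⁻¹ * d₀ ^ 2 := by
      rw [hd2, hc, ha, hr]
      linear_combination -1 / 4 * h3
    have hA : Tendsto (BorweinPi.aSeq d₀ b₀ a₀) atTop (𝓝 (1 / π)) :=
      BorweinPi.tendsto_aSeq hmem (by rw [hd2, ha, hb]; exact hrel)
    have hS : Tendsto (BorweinPi.aSimpSeq d₀ c₀ a₀) atTop (𝓝 (1 / π)) := by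
      rwa [BorweinPi.aSimpSeq_eq_aSeq hmem' hc']
    have hR := BorweinPi.tendsto_rSeq hmem ha' hS
    refine ⟨⟨hd0, hd2, hs', hc', ha'⟩, hA, hS, hR, ?_⟩
    rw [ht, funext (BorweinPi.tSeq_eq hmem' hs' c₀ r₀)]
    exact hR.comp (tendsto_id.const_mul_atTop' two_pos)
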